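/- Let $M$ be a non-empty smooth surface (a Hausdorff smooth $2$-manifold without boundary), not necessarily connected or orientable, and let $\phi : M \to \mathbb{C}^2$ be a smooth Lagrangian immersion, i.e. $\phi^*\omega = 0$ for the Kähler form $\omega(z,w) = -\operatorname{Im}(z_1\bar w_1 + z_2\bar w_2)$. Equip $M$ with the metric induced by the Euclidean metric $\langle z,w\rangle = \operatorname{Re}(z_1\bar w_1 + z_2\bar w_2)$. Let $\sigma$ be the second fundamental form of $\phi$, let $H = \frac12 \operatorname{trace}\sigma$ be its mean curvature vector, and let $\phi^\top$ and $\phi^\perp$ be the projections of the position vector $\phi$ to the tangent and to the normal planes of the immersion. Suppose that $\phi$ is a self-similar solution for mean curvature flow, i.e. $H = a\,\phi^\perp$ for a real constant $a \neq 0$. Then $\phi^\top$ is a smooth vector field on $M$, and $$\operatorname{div}\phi^\top = 2\left(1 + \frac{|H|^2}{a}\right)$$ on all of $M$, where $\operatorname{div}$ is the divergence for the induced metric. Consequently, if $M$ is compact, then $a < 0$, the area of $M$ is finite, $|H|^2$ is integrable, and $$\operatorname{Area}(M) = -\frac1a \int_M |H|^2,$$ where the area and the integral are taken with respect to the area measure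 of the induced metric. -/

import Mathlib

open scoped Manifold ContDiff
open MeasureTheory

namespace LagrangianSurface

noncomputable section

/-- The model of a surface: the Euclidean plane. -/
abbrev Plane : Type := EuclideanSpace ℝ (Fin 2)

/-- The complex Euclidean plane, with real inner product `⟪z, w⟫ = Re (∑ zᵢ w̄ᵢ)`. -/
abbrev C2 : Type := EuclideanSpace ℂ (Fin 2)

/-- The Kähler form `ω(z, w) = -Im (z, w)` of the complex Euclidean plane, where `(z, w) = ∑ zᵢ w̄ᵢ`
(conjugate-linear in the second variable). -/
def kaehlerForm (z w : C2) : ℝ := -(∑ i, z i * (starRingEnd ℂ) (w i)).im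

variable {M : Type*} [TopologicalSpace M] [ChartedSpace Plane M]

/-- The differential `dφ_p` of `φ : M → C2`. -/
def differential (φ : M → C2) (p : M) : TangentSpace (𝓡 2) p →L[ℝ] C2 :=
  mfderiv (𝓡 2) 𝓘(ℝ, C2) φ p

/-- `φ` is smooth and its differential is injective everywhere. -/
def IsSmoothImmersion (φ : M → C2) : Prop :=
  ContMDiff (𝓡 2) 𝓘(ℝ, C2) ∞ φ ∧ ∀ p : M, Function.Injective (differential φ p)

/-- `φ` pulls the Kähler form back to zero. -/
def IsLagrangian (φ : M → C2) : Prop :=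
  ∀ (p : M) (v w : TangentSpace (𝓡 2) p),
    kaehlerForm (differential φ p v) (differential φ p w) = 0

/-- The plane `dφ_p(T_pM)` tangent to the immersion. -/
def tangentPlane (φ : M → C2) (p : M) : Submodule ℝ C2 :=
  LinearMap.range (differential φ p).toLinearMap

/-- `φ^⊥`: the projection of the position vector to the normal plane. -/
def normalPart (φ : M → C2) (p : M) : C2 :=
  (tangentPlane φ p)ᗮ.starProjection (φ p)

/-- `φ^⊤` as a vector field on `M`: for an immersion, the unique tangent vector of `M` at `p` that
`dφ_p` maps to the projection of the position vector to the tangent plane. -/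
def tangentPart (φ : M → C2) (p : M) : TangentSpace (𝓡 2) p :=
  Function.invFun (differential φ p) ((tangentPlane φ p).starProjection (φ p))

/-! ### Local coordinates

All the coordinate expressions below are taken in the preferred chart at a point `p`. This is the
chart through which the tangent space at `p` is identified with the model plane. -/

/-- The `i`-th coordinate vector of the plane. -/
def coordVec (i : Fin 2) : Plane := EuclideanSpace.single i 1

/-- The partial derivative `∂ᵢ f`. -/
def pderiv {F : Type*} [NormedAddCommGroup F] [NormedSpace ℝ F] (i : Fin 2) (f : Plane → F)
    (x : Plane) : F :=
  fderiv ℝ f x (coordVec i)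

/-- `φ` read in the chart at `p`. -/
def localRep (φ : M → C2) (p : M) : Plane → C2 :=
  φ ∘ (extChartAt (𝓡 2) p).symm

/-- The matrix `gᵢⱼ = ⟪∂ᵢφ, ∂ⱼφ⟫` of the induced metric in the chart at `p`. -/
def metricMatrix (φ : M → C2) (p : M) (x : Plane) : Matrix (Fin 2) (Fin 2) ℝ :=
  Matrix.of fun i j => inner ℝ (pderiv i (localRep φ p) x) (pderiv j (localRep φ p) x)

/-- The Christoffel symbols
`Γᵏᵢⱼ = ½ ∑ₗ gᵏˡ (∂ᵢ gⱼₗ + ∂ⱼ gᵢₗ - ∂ₗ gᵢⱼ)` of the induced metric, in the chart at `p`. -/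
def christoffel (φ : M → C2) (p : M) (k i j : Fin 2) (x : Plane) : ℝ :=
  (1 / 2) * ∑ l, (metricMatrix φ p x)⁻¹ k l *
    (pderiv i (fun y => metricMatrix φ p y j l) x + pderiv j (fun y => metricMatrix φ p y i l) x
      - pderiv l (fun y => metricMatrix φ p y i j) x)

/-- The components of a vector field `X` on `M` in the chart at `p`. -/
def fieldRep (X : (q : M) → TangentSpace (𝓡 2) q) (p : M) (x : Plane) : Plane :=
  mfderiv (𝓡 2) 𝓘(ℝ, Plane) (extChartAt (𝓡 2) p) ((extChartAt (𝓡 2) p).symm x)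
    (X ((extChartAt (𝓡 2) p).symm x))

/-- The component `(∇ᵢ X)ᵏ = ∂ᵢ Xᵏ + ∑ⱼ Γᵏᵢⱼ Xʲ` of the covariant derivative of `X` for the
Levi-Civita connection of the induced metric, in the chart at `p`. -/
def covDeriv (φ : M → C2) (X : (q : M) → TangentSpace (𝓡 2) q) (p : M) (i k : Fin 2)
    (x : Plane) : ℝ :=
  pderiv i (fun y => fieldRep X p y k) x + ∑ j, christoffel φ p k i j x * fieldRep X p x j

/-- The divergence of the vector field `X` for the induced metric: the trace of `v ↦ ∇_v X`. -/
def divergence (φ : M → C2) (X : (q : M) → TangentSpace (𝓡 2) q) (p : M) : ℝ :=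
  ∑ i, covDeriv φ X p i i (extChartAt (𝓡 2) p p)

/-- The value `σ(∂ᵢ, ∂ⱼ)` at `p` of the second fundamental form on the coordinate fields of the
chart at `p`: the normal component of `∂ᵢ ∂ⱼ φ`. -/
def secondFundamentalForm (φ : M → C2) (p : M) (i j : Fin 2) : C2 :=
  (tangentPlane φ p)ᗮ.starProjection
    (pderiv i (pderiv j (localRep φ p)) (extChartAt (𝓡 2) p p))

/-- The mean curvature vector `H = ½ trace σ = ½ ∑ᵢⱼ gⁱʲ σ(∂ᵢ, ∂ⱼ)`. -/
def meanCurvature (φ : M → C2) (p : M) : C2 :=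
  (1 / 2 : ℝ) • ∑ i, ∑ j,
    (metricMatrix φ p (extChartAt (𝓡 2) p p))⁻¹ i j • secondFundamentalForm φ p i j

/-- `φ` is a self-similar solution for mean curvature flow with constant `a`: `a ≠ 0` and
`H = a φ^⊥`. -/
def IsSelfSimilar (φ : M → C2) (a : ℝ) : Prop :=
  a ≠ 0 ∧ ∀ p : M, meanCurvature φ p = a • normalPart φ p

/-- The area measure of the induced metric on the domain of the chart at `p`: the measure
`√(det g) dx` on the image of the chart, carried over to `M`. -/
def chartArea [MeasurableSpace M] (φ : M → C2) (p : M) : Measure M :=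
  (((volume : Measure Plane).restrict (extChartAt (𝓡 2) p).target).withDensity
    fun x => ENNReal.ofReal (Real.sqrt (metricMatrix φ p x).det)).map (extChartAt (𝓡 2) p).symm

/-- The area measure of the induced metric. The measures `chartArea φ p` agree on the overlaps of
the chart domains, so that (when countably many charts cover `M`) their supremum is the only measure
on `M` that restricts to `chartArea φ p` on the domain of the chart at `p`, for every `p`. -/
def areaMeasure [MeasurableSpace M] (φ : M → C2) : Measure M := ⨆ p : M, chartArea φ p

end

end LagrangianSurface

/-! Write `F` for the components of `φ^⊤` in a chart and `f` for `φ` read there. Since `f - df(F)`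
is normal, `∑ₖ gₗₖ Fᵏ = ⟪f, ∂ₗf⟫`. So `F` is `g⁻¹` applied to smooth functions, hence smooth.
Differentiating this identity, and using that the lowered Christoffel symbols of an induced metric
are `⟪∂ᵢ∂ⱼf, ∂ₗf⟫`, gives `∑ₖ gₗₖ (∇ᵢF)ᵏ = gᵢₗ + ⟪φ^⊥, ∂ᵢ∂ₗf⟫`. Its trace is `div φ^⊤ = 2 + 2⟪φ^⊥,
H⟫`, and `H = a φ^⊥` turns this into the first claim (`sum_covDeriv_eq`, `divergence_tangentPart`).

For compact `M`, the integral of `div φ^⊤` vanishes and the area formula follows; the area is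
positive, which forces `a < 0`. The divergence theorem is proved by a partition of unity from `√(det
g) div F = ∑ᵢ ∂ᵢ(√(det g) Fⁱ)` (`sum_pderiv_sqrt_det_mul`, `integral_mul_divergence_add`).

Divergence and mean curvature at a point are computed in the preferred chart at that point, whereas
integration needs one chart on an open set. The bridge is the chart invariance of the trace of the
normal Hessian (`normalTrace_comp`). Likewise the area measure, a supremum of chart measures,
restricts to each of them on its chart domain (`areaMeasure_restrict_source`). -/

open scoped Topology

namespace LagrangianSurface

/-! ### Coordinate calculus of the metric induced by a map on the plane. -/

section Local

variable {E : Type*} [NormedAddCommGroup E] [InnerProductSpace ℝ E]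

/-- The Gram matrix of the partial derivatives of `f`. -/
noncomputable def gramMatrix (f : Plane → E) (x : Plane) : Matrix (Fin 2) (Fin 2) ℝ :=
  Matrix.of fun i j => inner ℝ (pderiv i f x) (pderiv j f x)

/-- The Christoffel symbols of the metric induced by `f`. -/
noncomputable def gramChristoffel (f : Plane → E) (k i j : Fin 2) (x : Plane) : ℝ :=
  (1 / 2) * ∑ l, (gramMatrix f x)⁻¹ k l *
    (pderiv i (fun y => gramMatrix f y j l) x + pderiv j (fun y => gramMatrix f y i l) x
      - pderiv l (fun y => gramMatrix f y i j) x)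

theorem gramMatrix_apply (f : Plane → E) (x : Plane) (i j : Fin 2) :
    gramMatrix f x i j = inner ℝ (pderiv i f x) (pderiv j f x) := rfl

theorem gramMatrix_comm (f : Plane → E) (x : Plane) (i j : Fin 2) :
    gramMatrix f x i j = gramMatrix f x j i := real_inner_comm _ _

theorem plane_eq_sum (v : Plane) : v = ∑ i, v i • coordVec i := by
  ext j
  fin_cases j <;> simp [coordVec]

theorem map_eq_sum {F : Type*} [NormedAddCommGroup F] [NormedSpace ℝ F] (A : Plane →L[ℝ] F)
    (v : Plane) : A v = ∑ i, v i • A (coordVec i) := by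
  conv_lhs => rw [plane_eq_sum v]
  simp

theorem contDiffAt_pderiv {F : Type*} [NormedAddCommGroup F] [NormedSpace ℝ F] {f : Plane → F}
    {x : Plane} (hf : ContDiffAt ℝ ∞ f x) (i : Fin 2) : ContDiffAt ℝ ∞ (pderiv i f) x :=
  (hf.fderiv_right (m := ∞) (by simp)).clm_apply contDiffAt_const

theorem contDiffAt_gramMatrix {f : Plane → E} {x : Plane} (hf : ContDiffAt ℝ ∞ f x)
    (i j : Fin 2) : ContDiffAt ℝ ∞ (fun y => gramMatrix f y i j) x :=
  (contDiffAt_pderiv hf i).inner ℝ (contDiffAt_pderiv hf j)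

theorem contDiffAt_det_gramMatrix {f : Plane → E} {x : Plane} (hf : ContDiffAt ℝ ∞ f x) :
    ContDiffAt ℝ ∞ (fun y => (gramMatrix f y).det) x := by
  simp only [Matrix.det_fin_two]
  exact ((contDiffAt_gramMatrix hf 0 0).mul (contDiffAt_gramMatrix hf 1 1)).sub
    ((contDiffAt_gramMatrix hf 0 1).mul (contDiffAt_gramMatrix hf 1 0))

theorem det_gramMatrix_pos {f : Plane → E} {x : Plane}
    (hinj : Function.Injective (fderiv ℝ f x)) : 0 < (gramMatrix f x).det := by
  have hli : LinearIndependent ℝ fun i => pderiv i f x := by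
    have h := (EuclideanSpace.basisFun (Fin 2) ℝ).toBasis.linearIndependent.map'
      (fderiv ℝ f x).toLinearMap (LinearMap.ker_eq_bot.2 hinj)
    have h' : (fun i => pderiv i f x)
        = (fderiv ℝ f x).toLinearMap ∘ (EuclideanSpace.basisFun (Fin 2) ℝ).toBasis := by
      ext i
      simp [pderiv, coordVec]
    rw [h']
    exact h
  exact (Matrix.posDef_gram_of_linearIndependent (𝕜 := ℝ) hli).det_pos

/-- Cramer's rule: the entries of the inverse are those of the adjugate divided by a positive smooth
determinant. -/
theorem contDiffAt_inv_gramMatrix {f : Plane → E} {x : Plane} (hf : ContDiffAt ℝ ∞ f x)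
    (hinj : Function.Injective (fderiv ℝ f x)) (i j : Fin 2) :
    ContDiffAt ℝ ∞ (fun y => (gramMatrix f y)⁻¹ i j) x := by
  have hd := (contDiffAt_det_gramMatrix hf).inv (det_gramMatrix_pos hinj).ne'
  have hG := contDiffAt_gramMatrix hf
  simp only [Matrix.inv_def, Ring.inverse_eq_inv', Matrix.adjugate_fin_two, Matrix.smul_apply,
    smul_eq_mul]
  refine hd.mul ?_
  fin_cases i <;> fin_cases j <;> simp
  · exact hG 1 1
  · exact (hG 0 1).neg
  · exact (hG 1 0).neg
  · exact hG 0 0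

theorem isUnit_det_gramMatrix {f : Plane → E} {x : Plane}
    (hinj : Function.Injective (fderiv ℝ f x)) : IsUnit (gramMatrix f x).det :=
  (det_gramMatrix_pos hinj).ne'.isUnit

theorem pderiv_comm {f : Plane → E} {x : Plane} (hf : ContDiffAt ℝ ∞ f x) (i j : Fin 2) :
    pderiv i (pderiv j f) x = pderiv j (pderiv i f) x := by
  have hd : DifferentiableAt ℝ (fderiv ℝ f) x :=
    (hf.fderiv_right (m := ∞) (by simp)).differentiableAt (by simp)
  have key (i j : Fin 2) : pderiv i (pderiv j f) x = fderiv ℝ (fderiv ℝ f) x (coordVec i)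
      (coordVec j) := by
    have : HasFDerivAt (pderiv j f) ((fderiv ℝ (fderiv ℝ f) x).flip (coordVec j)) x := by
      have := hd.hasFDerivAt.clm_apply (hasFDerivAt_const (coordVec j) x)
      convert! this using 1
      ext v; simp
    rw [pderiv, this.fderiv]; rfl
  rw [key, key]
  exact (hf.isSymmSndFDerivAt (by simpa using (ENat.LEInfty.out : (2 : WithTop ℕ∞) ≤ ∞))).eq _ _

theorem pderiv_inner {u v : Plane → E} {x : Plane} (hu : DifferentiableAt ℝ u x)
    (hv : DifferentiableAt ℝ v x) (i : Fin 2) :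
    pderiv i (fun y => inner ℝ (u y) (v y)) x
      = inner ℝ (u x) (pderiv i v x) + inner ℝ (pderiv i u x) (v x) := by
  simp only [pderiv]
  exact fderiv_inner_apply ℝ hu hv _

/-- Lowering the index removes `g⁻¹`. Each `∂g` splits into two inner products; by symmetry of
second derivatives all cancel except two equal ones, which the factor `1/2` halves. -/
theorem sum_gramMatrix_mul_gramChristoffel {f : Plane → E} {x : Plane}
    (hf : ContDiffAt ℝ ∞ f x) (hinj : Function.Injective (fderiv ℝ f x)) (l i j : Fin 2) :
    ∑ k, gramMatrix f x l k * gramChristoffel f k i j x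
      = inner ℝ (pderiv i (pderiv j f) x) (pderiv l f x) := by
  set C : Fin 2 → ℝ := fun l => pderiv i (fun y => gramMatrix f y j l) x
    + pderiv j (fun y => gramMatrix f y i l) x - pderiv l (fun y => gramMatrix f y i j) x with hC
  have hd (i : Fin 2) : DifferentiableAt ℝ (pderiv i f) x :=
    (contDiffAt_pderiv hf i).differentiableAt (by simp)
  have h1 : (fun k => gramChristoffel f k i j x)
      = (1 / 2 : ℝ) • ((gramMatrix f x)⁻¹).mulVec C := by
    ext k
    simp only [gramChristoffel, Matrix.mulVec, dotProduct, hC, Pi.smul_apply, smul_eq_mul]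
  have h2 : (gramMatrix f x).mulVec (fun k => gramChristoffel f k i j x) = (1 / 2 : ℝ) • C := by
    rw [h1, Matrix.mulVec_smul, Matrix.mulVec_mulVec,
      Matrix.mul_nonsing_inv _ (isUnit_det_gramMatrix hinj), Matrix.one_mulVec]
  have h3 := congrFun h2 l
  simp only [Matrix.mulVec, dotProduct, Pi.smul_apply, smul_eq_mul] at h3
  rw [h3, hC]
  simp only [gramMatrix_apply]
  rw [pderiv_inner (hd _) (hd _), pderiv_inner (hd _) (hd _), pderiv_inner (hd _) (hd _),
    pderiv_comm hf j i, pderiv_comm hf l i, pderiv_comm hf l j]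
  simp only [real_inner_comm]
  ring

theorem pderiv_mul {u v : Plane → ℝ} {x : Plane} (hu : DifferentiableAt ℝ u x)
    (hv : DifferentiableAt ℝ v x) (i : Fin 2) :
    pderiv i (fun y => u y * v y) x = u x * pderiv i v x + pderiv i u x * v x := by
  simp only [pderiv]
  rw [fderiv_fun_mul hu hv]
  simp; ring

theorem differentiableAt_coord {F : Plane → Plane} {x : Plane} (hF : DifferentiableAt ℝ F x)
    (k : Fin 2) : DifferentiableAt ℝ (fun y => F y k) x := by
  exact (differentiableAt_euclidean.1 hF) k

/-- Obtained by differentiating `hfF` along `∂ᵢ`: of the two terms of `∂ᵢ gₗₖ`, one is the lowered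
Christoffel symbol, and the other pairs `∂ᵢ∂ₗf` with `df(F)`, turning `f` into its normal part. -/
theorem sum_gramMatrix_mul_covDeriv {f : Plane → E} {F : Plane → Plane} {x : Plane}
    (hf : ContDiffAt ℝ ∞ f x) (hinj : Function.Injective (fderiv ℝ f x))
    (hF : DifferentiableAt ℝ F x)
    (hfF : ∀ᶠ y in 𝓝 x, ∀ l, ∑ k, gramMatrix f y l k * F y k = inner ℝ (f y) (pderiv l f y))
    (i l : Fin 2) :
    ∑ k, gramMatrix f x l k *
        (pderiv i (fun y => F y k) x + ∑ j, gramChristoffel f k i j x * F x j)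
      = gramMatrix f x i l + inner ℝ (f x - fderiv ℝ f x (F x)) (pderiv i (pderiv l f) x) := by
  have hd (i : Fin 2) : DifferentiableAt ℝ (pderiv i f) x :=
    (contDiffAt_pderiv hf i).differentiableAt (by simp)
  have hG (i j : Fin 2) : DifferentiableAt ℝ (fun y => gramMatrix f y i j) x :=
    (contDiffAt_gramMatrix hf i j).differentiableAt (by simp)
  have hFk := differentiableAt_coord hF
  have e1 : pderiv i (fun y => ∑ k, gramMatrix f y l k * F y k) x
      = pderiv i (fun y => inner ℝ (f y) (pderiv l f y)) x := by
    rw [pderiv, pderiv, Filter.EventuallyEq.fderiv_eq (hfF.mono fun y hy => hy l)]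
  have e2 : pderiv i (fun y => ∑ k, gramMatrix f y l k * F y k) x
      = ∑ k, (gramMatrix f x l k * pderiv i (fun y => F y k) x
        + pderiv i (fun y => gramMatrix f y l k) x * F x k) := by
    simp only [← pderiv_mul (hG l _) (hFk _)]
    simp only [pderiv]
    rw [fderiv_fun_sum fun k _ => (hG l k).fun_mul (hFk k)]
    simp
  rw [e2, pderiv_inner (hf.differentiableAt (by simp)) (hd l)] at e1
  have e3 (k : Fin 2) : pderiv i (fun y => gramMatrix f y l k) x
      = inner ℝ (pderiv l f x) (pderiv i (pderiv k f) x)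
        + inner ℝ (pderiv i (pderiv l f) x) (pderiv k f x) :=
    pderiv_inner (hd _) (hd _) i
  have e4 (j : Fin 2) := sum_gramMatrix_mul_gramChristoffel hf hinj l i j
  have e5 : fderiv ℝ f x (F x) = ∑ k, F x k • pderiv k f x := map_eq_sum _ _
  have e6 : gramMatrix f x i l = inner ℝ (pderiv i f x) (pderiv l f x) := rfl
  rw [e5, inner_sub_left, sum_inner]
  simp only [e3] at e1
  simp only [Fin.sum_univ_two, inner_smul_left, RCLike.conj_to_real] at e1 e4 ⊢
  have e40 := e4 0
  have e41 := e4 1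
  rw [e6]
  rw [real_inner_comm] at e40 e41
  have c0 := real_inner_comm (pderiv i (pderiv l f) x) (pderiv 0 f x)
  have c1 := real_inner_comm (pderiv i (pderiv l f) x) (pderiv 1 f x)
  linear_combination e1 + F x 0 * e40 + F x 1 * e41 + F x 0 * c0 + F x 1 * c1

/-- The divergence formula in coordinates for the tangential part `F` of the position vector. -/
theorem sum_covDeriv_eq {f : Plane → E} {F : Plane → Plane} {x : Plane}
    (hf : ContDiffAt ℝ ∞ f x) (hinj : Function.Injective (fderiv ℝ f x))
    (hF : DifferentiableAt ℝ F x)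
    (hfF : ∀ᶠ y in 𝓝 x, ∀ l, ∑ k, gramMatrix f y l k * F y k = inner ℝ (f y) (pderiv l f y)) :
    ∑ i, (pderiv i (fun y => F y i) x + ∑ j, gramChristoffel f i i j x * F x j)
      = 2 + ∑ i, ∑ l, (gramMatrix f x)⁻¹ i l *
          inner ℝ (f x - fderiv ℝ f x (F x)) (pderiv i (pderiv l f) x) := by
  have hu := isUnit_det_gramMatrix hinj
  have key (i : Fin 2) : pderiv i (fun y => F y i) x + ∑ j, gramChristoffel f i i j x * F x j
      = 1 + ∑ l, (gramMatrix f x)⁻¹ i l *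
          inner ℝ (f x - fderiv ℝ f x (F x)) (pderiv i (pderiv l f) x) := by
    set c : Fin 2 → ℝ := fun k =>
      pderiv i (fun y => F y k) x + ∑ j, gramChristoffel f k i j x * F x j
    have h1 : (gramMatrix f x).mulVec c = fun l => gramMatrix f x i l
        + inner ℝ (f x - fderiv ℝ f x (F x)) (pderiv i (pderiv l f) x) :=
      funext fun l => sum_gramMatrix_mul_covDeriv hf hinj hF hfF i l
    have h2 := congrFun (congrArg ((gramMatrix f x)⁻¹).mulVec h1) i
    rw [Matrix.mulVec_mulVec, Matrix.nonsing_inv_mul _ hu, Matrix.one_mulVec] at h2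
    change c i = _
    rw [h2]
    simp only [Matrix.mulVec, dotProduct, mul_add, Finset.sum_add_distrib]
    congr 1
    -- The metric term contributes the diagonal entry `(g⁻¹ g)ᵢᵢ = 1`; the two indices together give
    -- the `2`.
    have h3 := congrFun (congrFun (Matrix.nonsing_inv_mul _ hu) i) i
    rw [Matrix.mul_apply, Matrix.one_apply_eq] at h3
    rw [← h3]
    exact Finset.sum_congr rfl fun l _ => by rw [gramMatrix_comm]
  rw [Finset.sum_congr rfl fun i _ => key i, Finset.sum_add_distrib]
  simp

/-- The density of the area measure is `√(det g)`, and `√(det g) div F = ∑ᵢ ∂ᵢ(√(det g) Fⁱ)`. -/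
theorem sum_pderiv_sqrt_det_mul {f : Plane → E} {F : Plane → Plane} {x : Plane}
    (hf : ContDiffAt ℝ ∞ f x) (hinj : Function.Injective (fderiv ℝ f x))
    (hF : DifferentiableAt ℝ F x) :
    ∑ i, pderiv i (fun y => √(gramMatrix f y).det * F y i) x
      = √(gramMatrix f x).det *
        ∑ i, (pderiv i (fun y => F y i) x + ∑ j, gramChristoffel f i i j x * F x j) := by
  have hpos := det_gramMatrix_pos hinj
  have hG (i j : Fin 2) : DifferentiableAt ℝ (fun y => gramMatrix f y i j) x :=
    (contDiffAt_gramMatrix hf i j).differentiableAt (by simp)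
  have hD : DifferentiableAt ℝ (fun y => (gramMatrix f y).det) x :=
    (contDiffAt_det_gramMatrix hf).differentiableAt (by simp)
  have hS : DifferentiableAt ℝ (fun y => √(gramMatrix f y).det) x := hD.sqrt hpos.ne'
  have e1 (i : Fin 2) : pderiv i (fun y => √(gramMatrix f y).det) x
      = pderiv i (fun y => (gramMatrix f y).det) x / (2 * √(gramMatrix f x).det) := by
    rw [pderiv, fderiv_sqrt hD hpos.ne']
    simp [pderiv]; ring
  have e2 (i : Fin 2) : pderiv i (fun y => (gramMatrix f y).det) x
      = gramMatrix f x 0 0 * pderiv i (fun y => gramMatrix f y 1 1) x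
        + pderiv i (fun y => gramMatrix f y 0 0) x * gramMatrix f x 1 1
        - (gramMatrix f x 0 1 * pderiv i (fun y => gramMatrix f y 1 0) x
        + pderiv i (fun y => gramMatrix f y 0 1) x * gramMatrix f x 1 0) := by
    rw [← pderiv_mul (hG _ _) (hG _ _), ← pderiv_mul (hG _ _) (hG _ _)]
    simp only [Matrix.det_fin_two, pderiv]
    rw [fderiv_fun_sub ((hG _ _).fun_mul (hG _ _)) ((hG _ _).fun_mul (hG _ _))]
    simp
  have e3 : (fun y => gramMatrix f y 1 0) = fun y => gramMatrix f y 0 1 :=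
    funext fun y => gramMatrix_comm f y 1 0
  have e4 : gramMatrix f x 1 0 = gramMatrix f x 0 1 := gramMatrix_comm f x 1 0
  have hs : √(gramMatrix f x).det * √(gramMatrix f x).det = (gramMatrix f x).det :=
    Real.mul_self_sqrt hpos.le
  have hs0 : √(gramMatrix f x).det ≠ 0 := (Real.sqrt_pos.2 hpos).ne'
  simp only [pderiv_mul hS (differentiableAt_coord hF _), e1, e2, gramChristoffel,
    Matrix.inv_def, Ring.inverse_eq_inv', Matrix.adjugate_fin_two, Matrix.smul_apply,
    smul_eq_mul, Fin.sum_univ_two, e3, e4, Matrix.of_apply, Matrix.cons_val', Matrix.cons_val_zero,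
    Matrix.cons_val_one, Matrix.cons_val_fin_one]
  -- With `s² = det g` the claim becomes a rational identity in `s`: it amounts to `∑ᵢ Γⁱᵢⱼ = ∂ⱼ(det
  -- g) / (2 det g)`.
  generalize √(gramMatrix f x).det = s at hs hs0 ⊢
  rw [← hs]
  field_simp
  ring

end Local

/-! ### Smoothness of the tangential part, changes of coordinates, integrals of partial derivatives.
-/

section Local

variable {E : Type*} [NormedAddCommGroup E] [InnerProductSpace ℝ E]

theorem contDiffAt_of_gramMatrix_mul {f : Plane → E} {F : Plane → Plane} {x : Plane}
    (hf : ContDiffAt ℝ ∞ f x) (hinj : ∀ᶠ y in 𝓝 x, Function.Injective (fderiv ℝ f y))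
    (hfF : ∀ᶠ y in 𝓝 x, ∀ l, ∑ k, gramMatrix f y l k * F y k = inner ℝ (f y) (pderiv l f y)) :
    ContDiffAt ℝ ∞ F x := by
  have h : ∀ᶠ y in 𝓝 x, ∀ i,
      F y i = ∑ l, (gramMatrix f y)⁻¹ i l * inner ℝ (f y) (pderiv l f y) := by
    filter_upwards [hinj, hfF] with y h1 h2 i
    have h3 : (gramMatrix f y).mulVec (F y) = fun l => inner ℝ (f y) (pderiv l f y) :=
      funext h2
    have h4 := congrFun (congrArg ((gramMatrix f y)⁻¹).mulVec h3) i
    rwa [Matrix.mulVec_mulVec, Matrix.nonsing_inv_mul _ (isUnit_det_gramMatrix h1),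
      Matrix.one_mulVec] at h4
  rw [contDiffAt_euclidean]
  intro i
  refine ContDiffAt.congr_of_eventuallyEq ?_ (h.mono fun y hy => hy i)
  exact ContDiffAt.sum fun l _ => (contDiffAt_inv_gramMatrix hf hinj.self_of_nhds i l).mul
    (hf.inner ℝ (contDiffAt_pderiv hf l))

/-- The Jacobian matrix of `τ` at `x`. -/
noncomputable def jacobian (τ : Plane → Plane) (x : Plane) : Matrix (Fin 2) (Fin 2) ℝ :=
  Matrix.of fun k i => pderiv i τ x k

theorem det_jacobian (τ : Plane → Plane) (x : Plane) :
    (jacobian τ x).det = (fderiv ℝ τ x).det := by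
  rw [ContinuousLinearMap.det, ← LinearMap.det_toMatrix (EuclideanSpace.basisFun (Fin 2) ℝ).toBasis]
  congr 1

theorem pderiv_comp {f : Plane → E} {τ : Plane → Plane} {x : Plane}
    (hf : DifferentiableAt ℝ f (τ x)) (hτ : DifferentiableAt ℝ τ x) (i : Fin 2) :
    pderiv i (f ∘ τ) x = ∑ k, pderiv i τ x k • pderiv k f (τ x) := by
  rw [pderiv, fderiv_comp x hf hτ, ContinuousLinearMap.comp_apply, map_eq_sum]
  rfl

theorem gramMatrix_comp {f h : Plane → E} {τ : Plane → Plane} {x : Plane}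
    (hh : h =ᶠ[𝓝 x] f ∘ τ) (hf : DifferentiableAt ℝ f (τ x)) (hτ : DifferentiableAt ℝ τ x) :
    gramMatrix h x = (jacobian τ x).transpose * gramMatrix f (τ x) * jacobian τ x := by
  ext i j
  have h1 (i : Fin 2) : pderiv i h x = ∑ k, pderiv i τ x k • pderiv k f (τ x) := by
    rw [← pderiv_comp hf hτ, pderiv, pderiv, hh.fderiv_eq]
  rw [gramMatrix_apply, h1, h1]
  simp only [Matrix.mul_apply, jacobian, Matrix.transpose_apply, Matrix.of_apply,
    inner_smul_left, inner_smul_right, inner_add_left, inner_add_right, gramMatrix_apply,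
    Fin.sum_univ_two, RCLike.conj_to_real]
  ring

theorem sqrt_det_gramMatrix_comp {f h : Plane → E} {τ : Plane → Plane} {x : Plane}
    (hh : h =ᶠ[𝓝 x] f ∘ τ) (hf : DifferentiableAt ℝ f (τ x)) (hτ : DifferentiableAt ℝ τ x) :
    √(gramMatrix h x).det = |(fderiv ℝ τ x).det| * √(gramMatrix f (τ x)).det := by
  rw [gramMatrix_comp hh hf hτ, Matrix.det_mul, Matrix.det_mul, Matrix.det_transpose,
    det_jacobian]
  rw [mul_right_comm, ← sq, Real.sqrt_mul (sq_nonneg _), Real.sqrt_sq_eq_abs]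

/-- The trace, for the metric induced by `f`, of the component of the Hessian of `f` along `n`. -/
noncomputable def normalTrace (f : Plane → E) (n : E) (x : Plane) : ℝ :=
  ∑ i, ∑ l, (gramMatrix f x)⁻¹ i l * inner ℝ n (pderiv i (pderiv l f) x)

/-- The second derivatives of `τ` enter the chain rule only as coefficients of the `∂ₖf`, which `n`
kills; so the component of the Hessian along `n` is tensorial. -/
theorem pderiv_pderiv_comp {f h : Plane → E} {τ : Plane → Plane} {x : Plane} {n : E}
    (hh : h =ᶠ[𝓝 x] f ∘ τ) (hf : ContDiffAt ℝ ∞ f (τ x)) (hτ : ContDiffAt ℝ ∞ τ x)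
    (hn : ∀ k, inner ℝ n (pderiv k f (τ x)) = 0) (i j : Fin 2) :
    inner ℝ n (pderiv i (pderiv j h) x) = ∑ l, ∑ k, pderiv i τ x l *
      (inner ℝ n (pderiv l (pderiv k f) (τ x)) * pderiv j τ x k) := by
  have hτd : DifferentiableAt ℝ τ x := hτ.differentiableAt (by simp)
  have hfd (k : Fin 2) : DifferentiableAt ℝ (pderiv k f) (τ x) :=
    (contDiffAt_pderiv hf k).differentiableAt (by simp)
  have hfc (k : Fin 2) : DifferentiableAt ℝ (pderiv k f ∘ τ) x := (hfd k).comp x hτd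
  have hJ (k : Fin 2) : DifferentiableAt ℝ (fun y => pderiv j τ y k) x :=
    differentiableAt_coord ((contDiffAt_pderiv hτ j).differentiableAt (by simp)) k
  have h1 : pderiv j h =ᶠ[𝓝 x] fun y => ∑ k, pderiv j τ y k • (pderiv k f ∘ τ) y := by
    -- `ContDiffAt.eventually` excludes the order `∞`, so the order is first lowered to `1`.
    have hf1 : ∀ᶠ y in 𝓝 (τ x), DifferentiableAt ℝ f y :=
      ((hf.of_le (m := 1) ENat.LEInfty.out).eventually (by simp)).mono
        fun y hy => hy.differentiableAt (by simp)
    have hτ1 : ∀ᶠ y in 𝓝 x, DifferentiableAt ℝ τ y :=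
      ((hτ.of_le (m := 1) ENat.LEInfty.out).eventually (by simp)).mono
        fun y hy => hy.differentiableAt (by simp)
    filter_upwards [hh.eventuallyEq_nhds, hτd.continuousAt.eventually hf1, hτ1] with y h1 h2 h3
    rw [pderiv, h1.fderiv_eq]
    exact pderiv_comp h2 h3 j
  have h2 : pderiv i (pderiv j h) x = ∑ k, (pderiv j τ x k • pderiv i (pderiv k f ∘ τ) x
      + pderiv i (fun y => pderiv j τ y k) x • pderiv k f (τ x)) := by
    rw [pderiv, h1.fderiv_eq, fderiv_fun_sum fun k _ => (hJ k).fun_smul (hfc k)]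
    simp only [fderiv_fun_smul (hJ _) (hfc _)]
    simp [pderiv]
  rw [h2]
  simp only [pderiv_comp (hfd _) hτd, inner_add_right, inner_smul_right, hn,
    Fin.sum_univ_two]
  ring

theorem normalTrace_eq_trace (f : Plane → E) (n : E) (x : Plane) :
    normalTrace f n x = ((gramMatrix f x)⁻¹ *
      (Matrix.of fun i l => inner ℝ n (pderiv i (pderiv l f) x)).transpose).trace := by
  simp [normalTrace, Matrix.trace, Matrix.mul_apply]

/-- Metric and normal Hessian both transform as `A ↦ Jᵀ A J`, so `J` cancels in the trace of `g⁻¹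
S`. -/
theorem normalTrace_comp {f h : Plane → E} {τ : Plane → Plane} {x : Plane} {n : E}
    (hh : h =ᶠ[𝓝 x] f ∘ τ) (hf : ContDiffAt ℝ ∞ f (τ x)) (hτ : ContDiffAt ℝ ∞ τ x)
    (hn : ∀ k, inner ℝ n (pderiv k f (τ x)) = 0) (hJ : (fderiv ℝ τ x).det ≠ 0) :
    normalTrace h n x = normalTrace f n (τ x) := by
  have hJu : IsUnit (jacobian τ x).det := by rw [det_jacobian]; exact hJ.isUnit
  have hS : (Matrix.of fun i l => inner ℝ n (pderiv i (pderiv l h) x)).transpose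
      = (jacobian τ x).transpose *
        (Matrix.of fun i l => inner ℝ n (pderiv i (pderiv l f) (τ x))).transpose *
        jacobian τ x := by
    ext i j
    simp only [Matrix.transpose_apply, Matrix.of_apply, Matrix.mul_apply, jacobian,
      pderiv_pderiv_comp hh hf hτ hn, Fin.sum_univ_two]
    ring
  rw [normalTrace_eq_trace, normalTrace_eq_trace, hS, gramMatrix_comp hh
    (hf.differentiableAt (by simp)) (hτ.differentiableAt (by simp)), Matrix.mul_inv_rev,
    Matrix.mul_inv_rev]
  set J := jacobian τ x
  set S := (Matrix.of fun i l => inner ℝ n (pderiv i (pderiv l f) (τ x))).transpose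
  set A := (gramMatrix f (τ x))⁻¹
  have hJt : J.transpose⁻¹ * J.transpose = 1 :=
    Matrix.nonsing_inv_mul _ (by rwa [Matrix.det_transpose])
  calc (J⁻¹ * (A * J.transpose⁻¹) * (J.transpose * S * J)).trace
      = (J⁻¹ * (A * (J.transpose⁻¹ * J.transpose) * S * J)).trace := by
        simp only [Matrix.mul_assoc]
    _ = (A * S).trace := by
        rw [hJt, Matrix.mul_one, Matrix.trace_mul_comm, Matrix.mul_assoc,
          Matrix.mul_nonsing_inv _ hJu, Matrix.mul_one]

theorem integrable_pderiv {W : Plane → ℝ} (hW : ContDiff ℝ 1 W) (hc : HasCompactSupport W)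
    (i : Fin 2) : Integrable (pderiv i W) :=
  ((hW.continuous_fderiv (by simp)).clm_apply continuous_const).integrable_of_hasCompactSupport
    (hc.fderiv_apply ℝ _)

/-- Integration by parts against the constant `1`. -/
theorem integral_pderiv_eq_zero {W : Plane → ℝ} (hW : ContDiff ℝ 1 W)
    (hc : HasCompactSupport W) (i : Fin 2) : ∫ x, pderiv i W x = 0 := by
  have h := integral_mul_fderiv_eq_neg_fderiv_mul_of_integrable (μ := (volume : Measure Plane))
    (f := fun _ => (1 : ℝ)) (g := W) (v := coordVec i) (by simp)
    (by simpa using! integrable_pderiv hW hc i)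
    (by simpa using hW.continuous.integrable_of_hasCompactSupport hc)
    (by simp) (fun x _ => hW.differentiable (by simp) x)
  simpa [pderiv] using h

end Local

/-! ### From coordinates to the surface: divergence, chart independence, smoothness. -/

section Charts

variable {M : Type*} [TopologicalSpace M] [ChartedSpace Plane M]

theorem metricMatrix_eq_gramMatrix (φ : M → C2) (p : M) (x : Plane) :
    metricMatrix φ p x = gramMatrix (localRep φ p) x := rfl

theorem sum_covDeriv_eq_sum_gramChristoffel (φ : M → C2) (X : (q : M) → TangentSpace (𝓡 2) q)
    (p : M) (x : Plane) :
    ∑ i, covDeriv φ X p i i x = ∑ i, (pderiv i (fun y => fieldRep X p y i) x +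
      ∑ j, gramChristoffel (localRep φ p) i i j x * fieldRep X p x j) := rfl

theorem differential_tangentPart (φ : M → C2) (p : M) :
    differential φ p (tangentPart φ p) = (tangentPlane φ p).starProjection (φ p) := by
  refine Function.invFun_eq ?_
  exact (tangentPlane φ p).starProjection_apply_mem (φ p)

theorem normalPart_mem (φ : M → C2) (p : M) : normalPart φ p ∈ (tangentPlane φ p)ᗮ :=
  Submodule.starProjection_apply_mem _ _

theorem eventually_mem_target {p : M} {x : Plane} (hx : x ∈ (extChartAt (𝓡 2) p).target) :
    ∀ᶠ y in 𝓝 x, y ∈ (extChartAt (𝓡 2) p).target :=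
  (isOpen_extChartAt_target p).mem_nhds hx

/-- Pairing with a normal vector makes the projection in `secondFundamentalForm` invisible; the `2`
undoes the `½` in `H`. -/
theorem normalTrace_self (φ : M → C2) (p : M) :
    normalTrace (localRep φ p) (normalPart φ p) (extChartAt (𝓡 2) p p)
      = 2 * inner ℝ (normalPart φ p) (meanCurvature φ p) := by
  have h (v : C2) : inner ℝ (normalPart φ p) ((tangentPlane φ p)ᗮ.starProjection v)
      = inner ℝ (normalPart φ p) v := by
    rw [← Submodule.inner_starProjection_left_eq_right,
      Submodule.starProjection_eq_self_iff.2 (normalPart_mem φ p)]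
  simp only [meanCurvature, inner_smul_right, inner_sum, secondFundamentalForm, h,
    metricMatrix_eq_gramMatrix, normalTrace]
  ring

variable [IsManifold (𝓡 2) ∞ M]

theorem contMDiffAt_extChartAt_symm {p : M} {x : Plane} (hx : x ∈ (extChartAt (𝓡 2) p).target) :
    ContMDiffAt 𝓘(ℝ, Plane) (𝓡 2) ∞ (extChartAt (𝓡 2) p).symm x :=
  (contMDiffOn_extChartAt_symm p).contMDiffAt ((isOpen_extChartAt_target p).mem_nhds hx)

theorem contMDiffAt_extChartAt_of_mem {p q : M} (hq : q ∈ (extChartAt (𝓡 2) p).source) :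
    ContMDiffAt (𝓡 2) 𝓘(ℝ, Plane) ∞ (extChartAt (𝓡 2) p) q :=
  contMDiffAt_extChartAt' (by rwa [extChartAt_source] at hq)

theorem contDiffAt_comp_extChartAt_symm {F : Type*} [NormedAddCommGroup F] [NormedSpace ℝ F]
    {φ : M → F} (hφ : ContMDiff (𝓡 2) 𝓘(ℝ, F) ∞ φ)
    {p : M} {x : Plane} (hx : x ∈ (extChartAt (𝓡 2) p).target) :
    ContDiffAt ℝ ∞ (φ ∘ (extChartAt (𝓡 2) p).symm) x :=
  contMDiffAt_iff_contDiffAt.1 ((hφ _).comp x (contMDiffAt_extChartAt_symm hx))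

/-- The chain rule for `φ` read in a chart, applied to a vector field read in the chart. -/
theorem fderiv_comp_extChartAt_symm_fieldRep {F : Type*} [NormedAddCommGroup F] [NormedSpace ℝ F]
    {φ : M → F} (hφ : ContMDiff (𝓡 2) 𝓘(ℝ, F) ∞ φ) (X : (q : M) → TangentSpace (𝓡 2) q)
    {p : M} {x : Plane} (hx : x ∈ (extChartAt (𝓡 2) p).target) :
    fderiv ℝ (φ ∘ (extChartAt (𝓡 2) p).symm) x (fieldRep X p x)
      = mfderiv (𝓡 2) 𝓘(ℝ, F) φ ((extChartAt (𝓡 2) p).symm x)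
          (X ((extChartAt (𝓡 2) p).symm x)) := by
  set e := extChartAt (𝓡 2) p
  have hq : e.symm x ∈ e.source := e.map_target hx
  have hex : e (e.symm x) = x := e.right_inv hx
  have h1 : φ =ᶠ[𝓝 (e.symm x)] (φ ∘ e.symm) ∘ e := by
    filter_upwards [(isOpen_extChartAt_source p).mem_nhds hq] with y hy
    simp only [Function.comp_apply]
    rw [e.left_inv hy]
  have h2 : MDifferentiableAt 𝓘(ℝ, Plane) 𝓘(ℝ, F) (φ ∘ e.symm) (e (e.symm x)) := by
    rw [hex]
    exact ((contDiffAt_comp_extChartAt_symm hφ hx).differentiableAt (by simp)).mdifferentiableAt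
  have h3 : MDifferentiableAt (𝓡 2) 𝓘(ℝ, Plane) e (e.symm x) :=
    (contMDiffAt_extChartAt_of_mem hq).mdifferentiableAt (by simp)
  rw [h1.mfderiv_eq, mfderiv_comp _ h2 h3, hex, mfderiv_eq_fderiv]
  rfl

theorem fderiv_localRep_eq_comp {φ : M → C2} (hφ : ContMDiff (𝓡 2) 𝓘(ℝ, C2) ∞ φ)
    {p : M} {x : Plane} (hx : x ∈ (extChartAt (𝓡 2) p).target) (v : Plane) :
    fderiv ℝ (localRep φ p) x v = differential φ ((extChartAt (𝓡 2) p).symm x)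
      (mfderiv 𝓘(ℝ, Plane) (𝓡 2) (extChartAt (𝓡 2) p).symm x v) := by
  have h := mfderiv_comp x (hφ.mdifferentiable (by simp) _)
    ((contMDiffAt_extChartAt_symm hx).mdifferentiableAt (by simp))
  rw [mfderiv_eq_fderiv] at h
  exact congrArg (fun A : Plane →L[ℝ] C2 => A v) h

theorem injective_mfderiv_extChartAt_symm {p : M} {x : Plane}
    (hx : x ∈ (extChartAt (𝓡 2) p).target) :
    Function.Injective (mfderiv 𝓘(ℝ, Plane) (𝓡 2) (extChartAt (𝓡 2) p).symm x) := by
  have : IsManifold (𝓡 2) 1 M := .of_le (n := ∞) ENat.LEInfty.out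
  have h := mfderiv_extChartAt_comp_mfderivWithin_extChartAt_symm (I := 𝓡 2) hx
  simp only [modelWithCornersSelf_coe, Set.range_id, mfderivWithin_univ] at h
  intro v w hvw
  have h1 := congrArg (fun A : Plane →L[ℝ] Plane => A v) h
  have h2 := congrArg (fun A : Plane →L[ℝ] Plane => A w) h
  refine h1.symm.trans (Eq.trans ?_ h2)
  exact congrArg (mfderiv (𝓡 2) 𝓘(ℝ, Plane) (extChartAt (𝓡 2) p) _) hvw

variable {φ : M → C2}

theorem IsSmoothImmersion.contDiffAt_localRep (himm : IsSmoothImmersion φ) {p : M} {x : Plane}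
    (hx : x ∈ (extChartAt (𝓡 2) p).target) : ContDiffAt ℝ ∞ (localRep φ p) x :=
  contDiffAt_comp_extChartAt_symm himm.1 hx

theorem IsSmoothImmersion.injective_fderiv_localRep (himm : IsSmoothImmersion φ) {p : M}
    {x : Plane} (hx : x ∈ (extChartAt (𝓡 2) p).target) :
    Function.Injective (fderiv ℝ (localRep φ p) x) := by
  intro v w hvw
  rw [fderiv_localRep_eq_comp himm.1 hx, fderiv_localRep_eq_comp himm.1 hx] at hvw
  exact injective_mfderiv_extChartAt_symm hx (himm.2 _ hvw)

theorem pderiv_localRep_mem_tangentPlane (himm : IsSmoothImmersion φ) {p : M}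
    {x : Plane} (hx : x ∈ (extChartAt (𝓡 2) p).target) (i : Fin 2) :
    pderiv i (localRep φ p) x ∈ tangentPlane φ ((extChartAt (𝓡 2) p).symm x) :=
  ⟨_, (fderiv_localRep_eq_comp himm.1 hx _).symm⟩

theorem fderiv_localRep_tangentPart (himm : IsSmoothImmersion φ) {p : M}
    {x : Plane} (hx : x ∈ (extChartAt (𝓡 2) p).target) :
    fderiv ℝ (localRep φ p) x (fieldRep (tangentPart φ) p x)
      = (tangentPlane φ ((extChartAt (𝓡 2) p).symm x)).starProjection (localRep φ p x) :=
  (fderiv_comp_extChartAt_symm_fieldRep himm.1 _ hx).trans (differential_tangentPart φ _)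

theorem normalPart_eq_sub (himm : IsSmoothImmersion φ) {p : M}
    {x : Plane} (hx : x ∈ (extChartAt (𝓡 2) p).target) :
    normalPart φ ((extChartAt (𝓡 2) p).symm x)
      = localRep φ p x - fderiv ℝ (localRep φ p) x (fieldRep (tangentPart φ) p x) := by
  rw [fderiv_localRep_tangentPart himm hx, normalPart, Submodule.starProjection_orthogonal]
  rfl

theorem inner_normalPart_pderiv (himm : IsSmoothImmersion φ) {p : M}
    {x : Plane} (hx : x ∈ (extChartAt (𝓡 2) p).target) (i : Fin 2) :
    inner ℝ (normalPart φ ((extChartAt (𝓡 2) p).symm x)) (pderiv i (localRep φ p) x) = 0 :=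
  Submodule.inner_left_of_mem_orthogonal (pderiv_localRep_mem_tangentPlane himm hx i)
    (normalPart_mem φ _)

/-- These are the normal equations of the orthogonal projection; they provide the hypothesis `hfF`
of the coordinate lemmas. -/
theorem sum_gramMatrix_mul_tangentPart (himm : IsSmoothImmersion φ) {p : M}
    {x : Plane} (hx : x ∈ (extChartAt (𝓡 2) p).target) (l : Fin 2) :
    ∑ k, gramMatrix (localRep φ p) x l k * fieldRep (tangentPart φ) p x k
      = inner ℝ (localRep φ p x) (pderiv l (localRep φ p) x) := by
  have h := inner_normalPart_pderiv himm hx l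
  rw [normalPart_eq_sub himm hx, inner_sub_left, sub_eq_zero] at h
  rw [h, map_eq_sum, sum_inner]
  refine Finset.sum_congr rfl fun k _ => ?_
  rw [inner_smul_left, gramMatrix_comm, mul_comm]
  rfl

theorem contDiffAt_fieldRep_tangentPart (himm : IsSmoothImmersion φ) {p : M}
    {x : Plane} (hx : x ∈ (extChartAt (𝓡 2) p).target) :
    ContDiffAt ℝ ∞ (fieldRep (tangentPart φ) p) x :=
  contDiffAt_of_gramMatrix_mul (himm.contDiffAt_localRep hx)
    ((eventually_mem_target hx).mono fun _ hy => himm.injective_fderiv_localRep hy)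
    ((eventually_mem_target hx).mono fun _ hy => sum_gramMatrix_mul_tangentPart himm hy)

/-- The divergence of `φ^⊤` computed in an arbitrary chart. -/
theorem sum_covDeriv_tangentPart (himm : IsSmoothImmersion φ) {p : M}
    {x : Plane} (hx : x ∈ (extChartAt (𝓡 2) p).target) :
    ∑ i, covDeriv φ (tangentPart φ) p i i x = 2 +
      normalTrace (localRep φ p) (normalPart φ ((extChartAt (𝓡 2) p).symm x)) x := by
  rw [sum_covDeriv_eq_sum_gramChristoffel, sum_covDeriv_eq (himm.contDiffAt_localRep hx)
    (himm.injective_fderiv_localRep hx)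
    ((contDiffAt_fieldRep_tangentPart himm hx).differentiableAt (by simp))
    ((eventually_mem_target hx).mono fun _ hy => sum_gramMatrix_mul_tangentPart himm hy),
    normalPart_eq_sub himm hx]
  rfl

theorem divergence_tangentPart (himm : IsSmoothImmersion φ) (p : M) :
    divergence φ (tangentPart φ) p
      = 2 + 2 * inner ℝ (normalPart φ p) (meanCurvature φ p) := by
  have h := sum_covDeriv_tangentPart himm (mem_extChartAt_target (I := 𝓡 2) p)
  rw [extChartAt_to_inv, normalTrace_self] at h
  exact h

theorem contDiffAt_transition {p q : M} {x : Plane} (hx : x ∈ (extChartAt (𝓡 2) q).target)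
    (hp : (extChartAt (𝓡 2) q).symm x ∈ (extChartAt (𝓡 2) p).source) :
    ContDiffAt ℝ ∞ (extChartAt (𝓡 2) p ∘ (extChartAt (𝓡 2) q).symm) x :=
  contMDiffAt_iff_contDiffAt.1
    ((contMDiffAt_extChartAt_of_mem hp).comp x (contMDiffAt_extChartAt_symm hx))

theorem localRep_eventuallyEq_comp {p q : M} {x : Plane} (hx : x ∈ (extChartAt (𝓡 2) q).target)
    (hp : (extChartAt (𝓡 2) q).symm x ∈ (extChartAt (𝓡 2) p).source) :
    localRep φ q =ᶠ[𝓝 x]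
      localRep φ p ∘ (extChartAt (𝓡 2) p ∘ (extChartAt (𝓡 2) q).symm) := by
  filter_upwards [(contMDiffAt_extChartAt_symm hx).continuousAt.preimage_mem_nhds
    ((isOpen_extChartAt_source p).mem_nhds hp)] with y hy
  simp only [localRep, Function.comp_apply]
  rw [(extChartAt (𝓡 2) p).left_inv hy]

theorem sqrt_det_gramMatrix_transition (himm : IsSmoothImmersion φ) {p q : M} {x : Plane}
    (hx : x ∈ (extChartAt (𝓡 2) q).target)
    (hp : (extChartAt (𝓡 2) q).symm x ∈ (extChartAt (𝓡 2) p).source) :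
    √(gramMatrix (localRep φ q) x).det
      = |(fderiv ℝ (extChartAt (𝓡 2) p ∘ (extChartAt (𝓡 2) q).symm) x).det| *
        √(gramMatrix (localRep φ p) (extChartAt (𝓡 2) p ((extChartAt (𝓡 2) q).symm x))).det :=
  sqrt_det_gramMatrix_comp (localRep_eventuallyEq_comp hx hp)
    ((himm.contDiffAt_localRep ((extChartAt (𝓡 2) p).map_source hp)).differentiableAt (by simp))
    ((contDiffAt_transition hx hp).differentiableAt (by simp))

/-- `normalTrace_self` gives this at the base point of a chart; the transition map from the
preferred chart at `q` carries it to any point of the chart at `p`. -/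
theorem normalTrace_localRep (himm : IsSmoothImmersion φ) {p : M} {x : Plane}
    (hx : x ∈ (extChartAt (𝓡 2) p).target) :
    normalTrace (localRep φ p) (normalPart φ ((extChartAt (𝓡 2) p).symm x)) x
      = 2 * inner ℝ (normalPart φ ((extChartAt (𝓡 2) p).symm x))
          (meanCurvature φ ((extChartAt (𝓡 2) p).symm x)) := by
  obtain ⟨q, hq⟩ : ∃ q, q = (extChartAt (𝓡 2) p).symm x := ⟨_, rfl⟩
  have hqp : q ∈ (extChartAt (𝓡 2) p).source := hq ▸ (extChartAt (𝓡 2) p).map_target hx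
  have hxq : extChartAt (𝓡 2) p q = x := by rw [hq, (extChartAt (𝓡 2) p).right_inv hx]
  have hq0 := extChartAt_to_inv (I := 𝓡 2) q
  have hqt := mem_extChartAt_target (I := 𝓡 2) q
  have hqp' : (extChartAt (𝓡 2) q).symm (extChartAt (𝓡 2) q q) ∈ (extChartAt (𝓡 2) p).source := by
    rwa [hq0]
  have hτ : (extChartAt (𝓡 2) p ∘ (extChartAt (𝓡 2) q).symm) (extChartAt (𝓡 2) q q) = x := by
    rw [Function.comp_apply, hq0, hxq]
  rw [← hq, ← normalTrace_self]
  symm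
  rw [normalTrace_comp (localRep_eventuallyEq_comp hqt hqp') _ (contDiffAt_transition hqt hqp'),
    hτ]
  · intro k
    rw [hτ, hq]
    exact inner_normalPart_pderiv himm hx k
  -- A degenerate transition map would make the area density in the chart at `q` vanish.
  · intro h0
    have h1 := sqrt_det_gramMatrix_transition himm hqt hqp'
    rw [h0, abs_zero, zero_mul] at h1
    exact (Real.sqrt_pos.2 (det_gramMatrix_pos (himm.injective_fderiv_localRep hqt))).ne' h1
  · rw [hτ]
    exact himm.contDiffAt_localRep hx

theorem sum_covDeriv_tangentPart_eq_divergence (himm : IsSmoothImmersion φ) {p : M} {x : Plane}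
    (hx : x ∈ (extChartAt (𝓡 2) p).target) :
    ∑ i, covDeriv φ (tangentPart φ) p i i x
      = divergence φ (tangentPart φ) ((extChartAt (𝓡 2) p).symm x) := by
  rw [sum_covDeriv_tangentPart himm hx, divergence_tangentPart himm, normalTrace_localRep himm hx]

/-- The trivialization of the tangent bundle at `p` is the differential of the chart, so smoothness
of a section can be read off from `fieldRep`. -/
theorem fieldRep_extChartAt (X : (q : M) → TangentSpace (𝓡 2) q) {p q : M}
    (hq : q ∈ (extChartAt (𝓡 2) p).source) :
    (trivializationAt Plane (TangentSpace (𝓡 2)) p ⟨q, X q⟩).2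
      = fieldRep X p (extChartAt (𝓡 2) p q) := by
  have : IsManifold (𝓡 2) 1 M := .of_le (n := ∞) ENat.LEInfty.out
  have hq' : q ∈ (chartAt Plane p).source := by rwa [extChartAt_source] at hq
  have h := TangentBundle.continuousLinearMapAt_trivializationAt (I := 𝓡 2) hq'
  have h1 := congrArg (fun A : TangentSpace (𝓡 2) q →L[ℝ] Plane => A (X q)) h
  rw [fieldRep, (extChartAt (𝓡 2) p).left_inv hq]
  refine Eq.trans ?_ h1
  rw [Bundle.Trivialization.continuousLinearMapAt_apply,
    Bundle.Trivialization.linearMapAt_apply, if_pos (by simpa using hq')]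

theorem contMDiff_tangentPart (himm : IsSmoothImmersion φ) :
    ContMDiff (𝓡 2) (𝓡 2).tangent ∞
      (fun p => (⟨p, tangentPart φ p⟩ : TangentBundle (𝓡 2) M)) := by
  intro p
  refine (Bundle.contMDiffAt_section p).2 ?_
  have h : ContMDiffAt (𝓡 2) 𝓘(ℝ, Plane) ∞
      (fieldRep (tangentPart φ) p ∘ extChartAt (𝓡 2) p) p :=
    (contMDiffAt_iff_contDiffAt.2 (contDiffAt_fieldRep_tangentPart himm
      (mem_extChartAt_target (I := 𝓡 2) p))).comp p contMDiffAt_extChartAt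
  refine h.congr_of_eventuallyEq ?_
  filter_upwards [(isOpen_extChartAt_source p).mem_nhds (mem_extChartAt_source (I := 𝓡 2) p)]
    with q hq
  exact fieldRep_extChartAt _ hq

end Charts

/-- Measures that agree on the overlaps of a family of sets with a countable subcover are glued
together by their supremum. -/
theorem iSup_restrict_eq {ι α : Type*} [MeasurableSpace α] (m : ι → Measure α) (U : ι → Set α)
    (hU : ∀ i, MeasurableSet (U i)) (h0 : ∀ i, m i (U i)ᶜ = 0)
    (hm : ∀ i j S, MeasurableSet S → S ⊆ U i → S ⊆ U j → m i S = m j S)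
    (c : ℕ → ι) (hc : ⋃ n, U (c n) = Set.univ) (i : ι) :
    (⨆ i, m i).restrict (U i) = m i := by
  set A : ℕ → Set α := disjointed fun n => U (c n) with hA
  have hAm (n : ℕ) : MeasurableSet (A n) := MeasurableSet.disjointed (fun n => hU _) n
  have hAU (n : ℕ) : A n ⊆ U (c n) := disjointed_subset _ n
  have hAd : Pairwise (Function.onFun Disjoint A) := disjoint_disjointed _
  have hAc : ⋃ n, A n = Set.univ := by rw [hA, iUnion_disjointed, hc]
  have hsum (ν : Measure α) {S : Set α} (hS : MeasurableSet S) : ν S = ∑' n, ν (S ∩ A n) := by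
    rw [← measure_iUnion (fun a b hab => (hAd hab).mono Set.inter_subset_right
      Set.inter_subset_right) fun n => hS.inter (hAm n), ← Set.inter_iUnion, hAc, Set.inter_univ]
  -- The glued measure, built on disjoint pieces `A n ⊆ U (c n)`. Every `m i` is its restriction to
  -- `U i`, so the supremum is at most `μ`; piece by piece it is also at least `μ`.
  set μ : Measure α := Measure.sum fun n => (m (c n)).restrict (A n) with hμ
  have hμS {S : Set α} (hS : MeasurableSet S) : μ S = ∑' n, m (c n) (S ∩ A n) := by
    rw [hμ, Measure.sum_apply _ hS]
    exact tsum_congr fun n => Measure.restrict_apply hS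
  have hmi (i : ι) : m i = μ.restrict (U i) := by
    ext S hS
    have h1 : m i S = m i (S ∩ U i) := by
      refine le_antisymm ?_ (measure_mono Set.inter_subset_left)
      calc m i S ≤ m i ((S ∩ U i) ∪ (U i)ᶜ) := measure_mono fun x hx => by
            by_cases h : x ∈ U i
            · exact Or.inl ⟨hx, h⟩
            · exact Or.inr h
        _ ≤ m i (S ∩ U i) + m i (U i)ᶜ := measure_union_le _ _
        _ = m i (S ∩ U i) := by rw [h0, add_zero]
    rw [Measure.restrict_apply hS, h1, hμS (hS.inter (hU i)), hsum (m i) (hS.inter (hU i))]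
    exact tsum_congr fun n => hm _ _ _ ((hS.inter (hU i)).inter (hAm n))
      (fun x hx => hx.1.2) fun x hx => hAU n hx.2
  have hsup : ⨆ i, m i = μ := by
    apply le_antisymm
    · refine iSup_le fun i => ?_
      rw [hmi i]
      exact Measure.restrict_le_self
    · refine Measure.le_iff.2 fun S hS => ?_
      rw [hμS hS, hsum (⨆ i, m i) hS]
      exact ENNReal.tsum_le_tsum fun n => le_iSup m (c n) _
  rw [hsup, ← hmi]

/-! ### The area measure: compatibility of charts, finiteness, positivity, integration in a chart.
-/

section Area

variable {M : Type*} [TopologicalSpace M] [ChartedSpace Plane M]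

theorem measurableSet_target_inter_preimage [MeasurableSpace M] [BorelSpace M] (p : M)
    {S : Set M} (hS : MeasurableSet S) :
    MeasurableSet ((extChartAt (𝓡 2) p).target ∩ (extChartAt (𝓡 2) p).symm ⁻¹' S) := by
  have hc := (continuousOn_extChartAt_symm (I := 𝓡 2) p).domRestrict.measurable
  have := (isOpen_extChartAt_target (I := 𝓡 2) p).measurableSet.subtype_image (hc hS)
  convert this using 1
  ext x
  simp [and_comm]

theorem measurableSet_extChartAt_source [MeasurableSpace M] [BorelSpace M] (p : M) :
    MeasurableSet (extChartAt (𝓡 2) p).source :=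
  (isOpen_extChartAt_source p).measurableSet

theorem aemeasurable_extChartAt_symm [MeasurableSpace M] [BorelSpace M] (p : M)
    (δ : Plane → ENNReal) :
    AEMeasurable (extChartAt (𝓡 2) p).symm
      (((volume : Measure Plane).restrict (extChartAt (𝓡 2) p).target).withDensity δ) :=
  ((continuousOn_extChartAt_symm (I := 𝓡 2) p).aemeasurable
    (isOpen_extChartAt_target p).measurableSet).mono_ac (withDensity_absolutelyContinuous _ _)

theorem chartArea_apply [MeasurableSpace M] [BorelSpace M] (φ : M → C2) (p : M) {S : Set M}
    (hS : MeasurableSet S) :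
    chartArea φ p S = ∫⁻ x in (extChartAt (𝓡 2) p).target ∩ (extChartAt (𝓡 2) p).symm ⁻¹' S,
      ENNReal.ofReal √(gramMatrix (localRep φ p) x).det := by
  rw [chartArea, Measure.map_apply_of_aemeasurable (aemeasurable_extChartAt_symm p _) hS,
    withDensity_apply', Measure.restrict_restrict' (isOpen_extChartAt_target p).measurableSet,
    Set.inter_comm]
  rfl

theorem chartArea_compl_source [MeasurableSpace M] [BorelSpace M] (φ : M → C2) (p : M) :
    chartArea φ p (extChartAt (𝓡 2) p).sourceᶜ = 0 := by
  rw [chartArea_apply φ p (measurableSet_extChartAt_source p).compl]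
  have : (extChartAt (𝓡 2) p).target ∩
      (extChartAt (𝓡 2) p).symm ⁻¹' (extChartAt (𝓡 2) p).sourceᶜ = ∅ := by
    ext x
    simp only [Set.mem_inter_iff, Set.mem_preimage, Set.mem_compl_iff, Set.mem_empty_iff_false,
      iff_false, not_and, not_not]
    exact fun hx => (extChartAt (𝓡 2) p).map_target hx
  rw [this]
  simp

variable [IsManifold (𝓡 2) ∞ M] {φ : M → C2}

/-- Change of variables along the transition map, whose factor `|det|` is the ratio of the two
densities. -/
theorem chartArea_eq_of_subset [MeasurableSpace M] [BorelSpace M] (himm : IsSmoothImmersion φ)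
    (p q : M) {S : Set M} (hS : MeasurableSet S) (hp : S ⊆ (extChartAt (𝓡 2) p).source)
    (hq : S ⊆ (extChartAt (𝓡 2) q).source) : chartArea φ p S = chartArea φ q S := by
  rw [chartArea_apply φ p hS, chartArea_apply φ q hS]
  set e := extChartAt (𝓡 2) p
  set e' := extChartAt (𝓡 2) q
  set s := e'.target ∩ e'.symm ⁻¹' S
  have himage : e.target ∩ e.symm ⁻¹' S = (e ∘ e'.symm) '' s := by
    ext x
    constructor
    · rintro ⟨hx, hxS⟩
      refine ⟨e' (e.symm x), ⟨e'.map_source (hq hxS), ?_⟩, ?_⟩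
      · rw [Set.mem_preimage, e'.left_inv (hq hxS)]
        exact hxS
      · rw [Function.comp_apply, e'.left_inv (hq hxS), e.right_inv hx]
    · rintro ⟨y, ⟨hy, hyS⟩, rfl⟩
      refine ⟨e.map_source (hp hyS), ?_⟩
      rw [Set.mem_preimage, Function.comp_apply, e.left_inv (hp hyS)]
      exact hyS
  have hinj : Set.InjOn (e ∘ e'.symm) s := fun x hx y hy hxy =>
    e'.symm.injOn hx.1 hy.1 (e.injOn (hp hx.2) (hp hy.2) hxy)
  rw [himage, lintegral_image_eq_lintegral_abs_det_fderiv_mul volume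
    (measurableSet_target_inter_preimage q hS) (fun x hx =>
      ((contDiffAt_transition hx.1 (hp hx.2)).differentiableAt
        (by simp)).hasFDerivAt.hasFDerivWithinAt) hinj]
  refine setLIntegral_congr_fun (measurableSet_target_inter_preimage q hS) fun x hx => ?_
  rw [sqrt_det_gramMatrix_transition himm hx.1 (hp hx.2), ENNReal.ofReal_mul (abs_nonneg _)]
  rfl

theorem areaMeasure_restrict_source [CompactSpace M] [MeasurableSpace M] [BorelSpace M]
    (himm : IsSmoothImmersion φ) (p : M) :
    (areaMeasure φ).restrict (extChartAt (𝓡 2) p).source = chartArea φ p := by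
  obtain ⟨s, hs, hsU⟩ := countable_cover_nhds_of_sigmaCompact
    fun q : M => extChartAt_source_mem_nhds (I := 𝓡 2) q
  have hne : s.Nonempty := by
    have : p ∈ ⋃ x ∈ s, (extChartAt (𝓡 2) x).source := by rw [hsU]; trivial
    obtain ⟨q, hq, -⟩ := Set.mem_iUnion₂.1 this
    exact ⟨q, hq⟩
  obtain ⟨c, rfl⟩ := hs.exists_eq_range hne
  exact iSup_restrict_eq (chartArea φ) (fun q => (extChartAt (𝓡 2) q).source)
    measurableSet_extChartAt_source (chartArea_compl_source φ)
    (fun i j S hS hi hj => chartArea_eq_of_subset himm i j hS hi hj) c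
    (by simpa only [Set.biUnion_range] using hsU) p

theorem continuousAt_sqrt_det_gramMatrix (himm : IsSmoothImmersion φ) {p : M} {x : Plane}
    (hx : x ∈ (extChartAt (𝓡 2) p).target) :
    ContinuousAt (fun y => √(gramMatrix (localRep φ p) y).det) x :=
  (contDiffAt_det_gramMatrix (himm.contDiffAt_localRep hx)).continuousAt.sqrt

theorem aemeasurable_density (himm : IsSmoothImmersion φ) (p : M) :
    AEMeasurable (fun x => ENNReal.ofReal √(gramMatrix (localRep φ p) x).det)
      ((volume : Measure Plane).restrict (extChartAt (𝓡 2) p).target) :=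
  (ContinuousOn.aemeasurable (fun _ hx =>
    (continuousAt_sqrt_det_gramMatrix himm hx).continuousWithinAt)
      (isOpen_extChartAt_target p).measurableSet).ennreal_ofReal

theorem isFiniteMeasure_areaMeasure [CompactSpace M] [MeasurableSpace M] [BorelSpace M]
    (himm : IsSmoothImmersion φ) : IsFiniteMeasure (areaMeasure φ) := by
  -- By compactness local finiteness suffices: the continuous density is bounded on a small
  -- coordinate ball.
  refine ⟨isCompact_univ.measure_lt_top_of_nhdsWithin fun p _ => ?_⟩
  rw [nhdsWithin_univ]
  set e := extChartAt (𝓡 2) p with he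
  set x := e p
  have hx : x ∈ e.target := mem_extChartAt_target p
  have h1 : ∀ᶠ y in 𝓝 x, √(gramMatrix (localRep φ p) y).det
      < √(gramMatrix (localRep φ p) x).det + 1 :=
    (continuousAt_sqrt_det_gramMatrix himm hx).eventually (gt_mem_nhds (lt_add_one _))
  obtain ⟨r, hr, hrB⟩ := Metric.eventually_nhds_iff_ball.1 h1
  set S : Set M := e.source ∩ e ⁻¹' Metric.ball x r
  have hSo : IsOpen S := (continuousOn_extChartAt p).isOpen_inter_preimage
    (isOpen_extChartAt_source p) Metric.isOpen_ball
  refine ⟨S, hSo.mem_nhds ⟨mem_extChartAt_source p, Metric.mem_ball_self hr⟩, ?_⟩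
  have h2 : areaMeasure φ S = chartArea φ p S := by
    rw [← areaMeasure_restrict_source himm p, Measure.restrict_apply hSo.measurableSet,
      Set.inter_eq_left.2 Set.inter_subset_left]
  have hsub : e.target ∩ e.symm ⁻¹' S ⊆ Metric.ball x r := by
    rintro y ⟨hy, -, hyS⟩
    rwa [Set.mem_preimage, e.right_inv hy] at hyS
  rw [h2, chartArea_apply φ p hSo.measurableSet]
  calc _ ≤ ∫⁻ _ in e.target ∩ e.symm ⁻¹' S,
          ENNReal.ofReal (√(gramMatrix (localRep φ p) x).det + 1) :=
        setLIntegral_mono' (measurableSet_target_inter_preimage p hSo.measurableSet)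
          fun y hy => ENNReal.ofReal_le_ofReal (hrB y (hsub hy)).le
    _ = ENNReal.ofReal (√(gramMatrix (localRep φ p) x).det + 1)
          * volume (e.target ∩ e.symm ⁻¹' S) := setLIntegral_const _ _
    _ < ⊤ := ENNReal.mul_lt_top ENNReal.ofReal_lt_top
        ((measure_mono hsub).trans_lt measure_ball_lt_top)

theorem areaMeasure_univ_ne_zero [Nonempty M] [MeasurableSpace M] [BorelSpace M]
    (himm : IsSmoothImmersion φ) : areaMeasure φ Set.univ ≠ 0 := by
  obtain ⟨p⟩ := ‹Nonempty M›
  intro h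
  have h1 : chartArea φ p Set.univ = 0 :=
    le_antisymm ((le_iSup (chartArea φ) p Set.univ).trans h.le) zero_le
  have ho := isOpen_extChartAt_target (I := 𝓡 2) p
  rw [chartArea_apply φ p MeasurableSet.univ, Set.preimage_univ, Set.inter_univ,
    lintegral_eq_zero_iff' (aemeasurable_density himm p)] at h1
  have h2 := (ae_restrict_iff' ho.measurableSet).1 h1
  have h3 : volume (extChartAt (𝓡 2) p).target = 0 := by
    refine measure_mono_null (fun x hx => ?_) h2
    simp only [Set.mem_compl_iff, Set.mem_ofPred_eq, Pi.zero_apply, ENNReal.ofReal_eq_zero, not_le,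
      Classical.not_imp]
    exact ⟨hx, Real.sqrt_pos.2 (det_gramMatrix_pos (himm.injective_fderiv_localRep hx))⟩
  exact (ho.measure_pos volume ⟨_, mem_extChartAt_target p⟩).ne' h3

theorem integral_areaMeasure_eq [CompactSpace M] [MeasurableSpace M] [BorelSpace M]
    (himm : IsSmoothImmersion φ) (p : M) {v : M → ℝ} (hv : Continuous v)
    (hvp : ∀ q ∉ (extChartAt (𝓡 2) p).source, v q = 0) :
    ∫ q, v q ∂(areaMeasure φ) = ∫ x in (extChartAt (𝓡 2) p).target,
      √(gramMatrix (localRep φ p) x).det * v ((extChartAt (𝓡 2) p).symm x) := by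
  rw [← setIntegral_eq_integral_of_forall_compl_eq_zero hvp, areaMeasure_restrict_source himm,
    chartArea, integral_map (aemeasurable_extChartAt_symm p _) hv.aestronglyMeasurable]
  simp only [metricMatrix_eq_gramMatrix]
  rw [integral_withDensity_eq_integral_toReal_smul₀ (aemeasurable_density himm p)
      (ae_of_all _ fun _ => ENNReal.ofReal_lt_top)]
  refine integral_congr_ae (ae_of_all _ fun x => ?_)
  simp only [smul_eq_mul]
  rw [ENNReal.toReal_ofReal (Real.sqrt_nonneg _)]

end Area

/-! ### The divergence theorem for the tangential part of the position vector. -/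

section Divergence

variable {M : Type*} [TopologicalSpace M] [ChartedSpace Plane M] [IsManifold (𝓡 2) ∞ M]
  {φ : M → C2}

/-- The derivative of `ρ` along `φ^⊤`. -/
noncomputable def derivAlong (φ : M → C2) {F : Type*} [NormedAddCommGroup F] [NormedSpace ℝ F]
    (ρ : M → F) (q : M) : F :=
  mfderiv (𝓡 2) 𝓘(ℝ, F) ρ q (tangentPart φ q)

theorem derivAlong_eq_fderiv {F : Type*} [NormedAddCommGroup F] [NormedSpace ℝ F] {ρ : M → F}
    (hρ : ContMDiff (𝓡 2) 𝓘(ℝ, F) ∞ ρ) {p q : M} (hq : q ∈ (extChartAt (𝓡 2) p).source) :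
    derivAlong φ ρ q = fderiv ℝ (ρ ∘ (extChartAt (𝓡 2) p).symm) (extChartAt (𝓡 2) p q)
      (fieldRep (tangentPart φ) p (extChartAt (𝓡 2) p q)) := by
  rw [fderiv_comp_extChartAt_symm_fieldRep hρ _ ((extChartAt (𝓡 2) p).map_source hq),
    (extChartAt (𝓡 2) p).left_inv hq]
  rfl

/-- The derivative of a smooth function along `φ^⊤` is continuous. -/
theorem continuous_derivAlong (himm : IsSmoothImmersion φ) {F : Type*}
    [NormedAddCommGroup F] [NormedSpace ℝ F] {ρ : M → F} (hρ : ContMDiff (𝓡 2) 𝓘(ℝ, F) ∞ ρ) :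
    Continuous (derivAlong φ ρ) := by
  rw [continuous_iff_continuousAt]
  intro p
  have hx := mem_extChartAt_target (I := 𝓡 2) p
  have h1 : ContinuousAt (fun x => fderiv ℝ (ρ ∘ (extChartAt (𝓡 2) p).symm) x
      (fieldRep (tangentPart φ) p x)) (extChartAt (𝓡 2) p p) :=
    (((contDiffAt_comp_extChartAt_symm hρ hx).fderiv_right (m := ∞) (by simp)).clm_apply
      (contDiffAt_fieldRep_tangentPart himm hx)).continuousAt
  have h2 := ContinuousAt.comp (f := extChartAt (𝓡 2) p) h1 (continuousAt_extChartAt p)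
  refine h2.congr ?_
  filter_upwards [extChartAt_source_mem_nhds (I := 𝓡 2) p] with q hq
  exact (derivAlong_eq_fderiv hρ hq).symm

/-- Writing `φ^⊥ = φ - dφ(φ^⊤)` reduces this to the derivative of `φ` along a smooth field, with no
need to vary the projection. -/
theorem continuous_normalPart (himm : IsSmoothImmersion φ) : Continuous (normalPart φ) := by
  have h : normalPart φ = fun q => φ q - differential φ q (tangentPart φ q) := by
    ext1 q
    rw [differential_tangentPart, normalPart, Submodule.starProjection_orthogonal]
    rfl
  rw [h]
  exact himm.1.continuous.sub (continuous_derivAlong himm himm.1)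

/-- The divergence theorem for `ρ φ^⊤`, where `ρ` is supported in the domain of a chart. -/
theorem integral_mul_divergence_add [CompactSpace M] [MeasurableSpace M] [BorelSpace M]
    (himm : IsSmoothImmersion φ) (hdiv : Continuous (divergence φ (tangentPart φ)))
    (p : M) {ρ : M → ℝ} (hρ : ContMDiff (𝓡 2) 𝓘(ℝ, ℝ) ∞ ρ)
    (hρp : tsupport ρ ⊆ (extChartAt (𝓡 2) p).source) :
    ∫ q, (ρ q * divergence φ (tangentPart φ) q
      + derivAlong φ ρ q) ∂(areaMeasure φ) = 0 := by
  set e := extChartAt (𝓡 2) p with he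
  set f := localRep φ p
  set F := fieldRep (tangentPart φ) p
  set r : Plane → ℝ := ρ ∘ e.symm with hr
  have hto : IsOpen e.target := isOpen_extChartAt_target p
  have hvc : Continuous fun q => ρ q * divergence φ (tangentPart φ) q + derivAlong φ ρ q :=
    (hρ.continuous.mul hdiv).add (continuous_derivAlong himm hρ)
  have hmf : ∀ q ∉ tsupport ρ, derivAlong φ ρ q = 0 := by
    intro q hq
    rw [derivAlong, (notMem_tsupport_iff_eventuallyEq.1 hq).mfderiv_eq]
    change mfderiv (𝓡 2) 𝓘(ℝ, ℝ) (fun _ => (0 : ℝ)) q (tangentPart φ q) = 0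
    rw [mfderiv_const]
    rfl
  rw [integral_areaMeasure_eq himm p hvc fun q hq => by
    have hq' := fun h => hq (hρp h)
    simp only [image_eq_zero_of_notMem_tsupport hq', zero_mul, zero_add]
    exact hmf q hq']
  -- The field `√(det g) ρ F` extended by zero. It is `C¹` on the whole plane because it vanishes
  -- off the compact set `K`, the chart image of the support of `ρ`, inside the target.
  set W : Fin 2 → Plane → ℝ := fun i =>
    e.target.indicator fun x => √(gramMatrix f x).det * (r x * F x i) with hW
  have hWt (i : Fin 2) {x : Plane} (hx : x ∈ e.target) :
      W i =ᶠ[𝓝 x] fun x => √(gramMatrix f x).det * (r x * F x i) :=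
    Filter.eventuallyEq_of_mem (hto.mem_nhds hx) fun y hy => Set.indicator_of_mem hy _
  set K : Set Plane := e '' tsupport ρ
  have hK : IsCompact K :=
    (isClosed_tsupport ρ).isCompact.image_of_continuousOn
      ((continuousOn_extChartAt p).mono hρp)
  have hKt : K ⊆ e.target := by
    rintro _ ⟨q, hq, rfl⟩
    exact e.map_source (hρp hq)
  have hWK (i : Fin 2) : ∀ x ∉ K, W i x = 0 := by
    intro x hx
    by_cases hxt : x ∈ e.target
    · have : r x = 0 := image_eq_zero_of_notMem_tsupport (f := ρ) (x := e.symm x)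
        fun h => hx ⟨_, h, e.right_inv hxt⟩
      simp [hW, hxt, this]
    · exact Set.indicator_of_notMem hxt _
  have hWK' (i : Fin 2) {x : Plane} (hx : x ∉ K) : W i =ᶠ[𝓝 x] fun _ => 0 :=
    Filter.eventuallyEq_of_mem (hK.isClosed.isOpen_compl.mem_nhds hx) (hWK i)
  have hrs {x : Plane} (hx : x ∈ e.target) : ContDiffAt ℝ ∞ r x :=
    contDiffAt_comp_extChartAt_symm hρ hx
  have hFs {x : Plane} (hx : x ∈ e.target) : ContDiffAt ℝ ∞ F x :=
    contDiffAt_fieldRep_tangentPart himm hx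
  have hWs (i : Fin 2) : ContDiff ℝ 1 (W i) := by
    rw [contDiff_iff_contDiffAt]
    intro x
    by_cases hx : x ∈ K
    · refine ContDiffAt.congr_of_eventuallyEq ?_ (hWt i (hKt hx))
      have h1 := (contDiffAt_det_gramMatrix (himm.contDiffAt_localRep (hKt hx))).sqrt
        (det_gramMatrix_pos (himm.injective_fderiv_localRep (hKt hx))).ne'
      exact (h1.mul ((hrs (hKt hx)).mul (contDiffAt_euclidean.1 (hFs (hKt hx)) i))).of_le
        ENat.LEInfty.out
    · exact contDiffAt_const.congr_of_eventuallyEq (hWK' i hx)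
  have hWc (i : Fin 2) : HasCompactSupport (W i) := HasCompactSupport.intro hK (hWK i)
  have key : ∀ x ∈ e.target, √(gramMatrix f x).det *
      (ρ (e.symm x) * divergence φ (tangentPart φ) (e.symm x)
        + derivAlong φ ρ (e.symm x))
      = ∑ i, pderiv i (W i) x := by
    intro x hx
    have hrd : DifferentiableAt ℝ r x := (hrs hx).differentiableAt (by simp)
    have hFd : DifferentiableAt ℝ F x := (hFs hx).differentiableAt (by simp)
    have h1 := sum_pderiv_sqrt_det_mul (himm.contDiffAt_localRep hx)
      (himm.injective_fderiv_localRep hx) (hrd.fun_smul hFd)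
    have h2 (i : Fin 2) : pderiv i (W i) x
        = pderiv i (fun y => √(gramMatrix f y).det * (r y • F y) i) x := by
      rw [pderiv, (hWt i hx).fderiv_eq]
      rfl
    have h3 := derivAlong_eq_fderiv (φ := φ) hρ (e.map_target hx)
    rw [← he, e.right_inv hx, map_eq_sum] at h3
    have h4 := sum_covDeriv_tangentPart_eq_divergence himm hx
    rw [sum_covDeriv_eq_sum_gramChristoffel] at h4
    have h5 (i : Fin 2) : pderiv i (fun y => (r y • F y) i) x
        = r x * pderiv i (fun y => F y i) x + pderiv i r x * F x i :=
      pderiv_mul hrd (differentiableAt_coord hFd i) i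
    rw [Finset.sum_congr rfl fun i _ => h2 i, h1, h3, ← h4]
    simp only [h5]
    simp only [Fin.sum_univ_two, PiLp.smul_apply, smul_eq_mul, pderiv, hr, Function.comp_apply]
    ring
  -- The partial derivatives of `W` vanish outside the target, so the integral extends to the whole
  -- plane.
  rw [setIntegral_congr_fun hto.measurableSet key,
    setIntegral_eq_integral_of_forall_compl_eq_zero fun x hx => Finset.sum_eq_zero fun i _ => by
      rw [pderiv, (hWK' i fun h => hx (hKt h)).fderiv_eq]
      simp,
    integral_finsetSum _ fun i _ => integrable_pderiv (hWs i) (hWc i) i]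
  exact Finset.sum_eq_zero fun i _ => integral_pderiv_eq_zero (hWs i) (hWc i) i

/-- The divergence theorem for `φ^⊤` on a compact surface. -/
theorem integral_divergence_tangentPart [T2Space M] [CompactSpace M] [MeasurableSpace M]
    [BorelSpace M] (himm : IsSmoothImmersion φ)
    (hdiv : Continuous (divergence φ (tangentPart φ))) :
    ∫ q, divergence φ (tangentPart φ) q ∂(areaMeasure φ) = 0 := by
  have := isFiniteMeasure_areaMeasure himm
  obtain ⟨t, -, ht⟩ := isCompact_univ.elim_nhds_subcover
    (fun p : M => (extChartAt (𝓡 2) p).source) fun p _ => extChartAt_source_mem_nhds p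
  obtain ⟨ρ, hρ⟩ := SmoothPartitionOfUnity.exists_isSubordinate (𝓡 2) isClosed_univ
    (fun p : t => (extChartAt (𝓡 2) (p : M)).source) (fun p => isOpen_extChartAt_source _)
    (fun x hx => by simpa using ht hx)
  have hsum (q : M) : ∑ i, ρ i q = 1 := by
    rw [← finsum_eq_sum_of_fintype]
    exact ρ.sum_eq_one (Set.mem_univ q)
  -- The `ρ i` sum to the constant `1`, so their derivatives along `φ^⊤` cancel.
  have hdsum (q : M) :
      ∑ i, derivAlong φ (ρ i) q = 0 := by
    have hq := mem_extChartAt_source (I := 𝓡 2) q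
    simp only [derivAlong_eq_fderiv (ρ _).contMDiff hq]
    rw [← sum_apply, ← fderiv_fun_sum fun i _ => (contDiffAt_comp_extChartAt_symm
      (ρ i).contMDiff ((extChartAt (𝓡 2) q).map_source hq)).differentiableAt (by simp)]
    simp only [Function.comp_apply, hsum]
    simp
  have hint (i : t) : Integrable (fun q => ρ i q * divergence φ (tangentPart φ) q
      + derivAlong φ (ρ i) q) (areaMeasure φ) :=
    (((ρ i).contMDiff.continuous.mul hdiv).add
      (continuous_derivAlong himm (ρ i).contMDiff)).integrable_of_hasCompactSupport
        (HasCompactSupport.of_compactSpace _)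
  calc ∫ q, divergence φ (tangentPart φ) q ∂(areaMeasure φ)
      = ∫ q, ∑ i, (ρ i q * divergence φ (tangentPart φ) q
          + derivAlong φ (ρ i) q) ∂(areaMeasure φ) := by
        refine integral_congr_ae (ae_of_all _ fun q => ?_)
        simp only
        rw [Finset.sum_add_distrib, ← Finset.sum_mul, hsum, hdsum, one_mul, add_zero]
    _ = 0 := by
        rw [integral_finsetSum _ fun i _ => hint i]
        exact Finset.sum_eq_zero fun i _ =>
          integral_mul_divergence_add himm hdiv i (ρ i).contMDiff (hρ i)

theorem divergence_tangentPart_of_isSelfSimilar (himm : IsSmoothImmersion φ) {a : ℝ}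
    (hself : IsSelfSimilar φ a) (p : M) :
    divergence φ (tangentPart φ) p = 2 * (1 + ‖meanCurvature φ p‖ ^ 2 / a) := by
  have ha := hself.1
  rw [divergence_tangentPart himm, hself.2 p, norm_smul, inner_smul_right,
    real_inner_self_eq_norm_sq, mul_pow, Real.norm_eq_abs, sq_abs]
  field_simp

end Divergence

end LagrangianSurface

open LagrangianSurface in
theorem proposition1 {M : Type*} [TopologicalSpace M] [T2Space M] [Nonempty M]
    [ChartedSpace Plane M] [IsManifold (𝓡 2) ∞ M] [MeasurableSpace M] [BorelSpace M]
    (φ : M → C2) (a : ℝ) (himm : IsSmoothImmersion φ) (hlag : IsLagrangian φ)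
    (hself : IsSelfSimilar φ a) :
    (ContMDiff (𝓡 2) (𝓡 2).tangent ∞
        (fun p => (⟨p, tangentPart φ p⟩ : TangentBundle (𝓡 2) M)) ∧
      ∀ p : M, divergence φ (tangentPart φ) p = 2 * (1 + ‖meanCurvature φ p‖ ^ 2 / a)) ∧
    (CompactSpace M →
      a < 0 ∧
      areaMeasure φ Set.univ < ⊤ ∧
      Integrable (fun p => ‖meanCurvature φ p‖ ^ 2) (areaMeasure φ) ∧
      (areaMeasure φ).real Set.univ
        = -(1 / a) * ∫ p, ‖meanCurvature φ p‖ ^ 2 ∂(areaMeasure φ)) := by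
  refine ⟨⟨contMDiff_tangentPart himm, divergence_tangentPart_of_isSelfSimilar himm hself⟩,
    fun _ => ?_⟩
  have hfin := isFiniteMeasure_areaMeasure himm
  have ha := hself.1
  -- Self-similarity gives continuity of `H` through `φ^⊥`, although the definition of `H` changes
  -- chart from point to point.
  have hH : Continuous fun p => ‖meanCurvature φ p‖ ^ 2 := by
    rw [show meanCurvature φ = fun p => a • normalPart φ p from funext hself.2]
    exact (((continuous_normalPart himm).const_smul a).norm).pow 2
  have hint : Integrable (fun p => ‖meanCurvature φ p‖ ^ 2) (areaMeasure φ) :=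
    hH.integrable_of_hasCompactSupport (HasCompactSupport.of_compactSpace _)
  have hdiv : divergence φ (tangentPart φ)
      = fun p => 2 * (1 + ‖meanCurvature φ p‖ ^ 2 / a) :=
    funext (divergence_tangentPart_of_isSelfSimilar himm hself)
  have h0 := integral_divergence_tangentPart himm
    (by rw [hdiv]; exact continuous_const.mul (continuous_const.add (hH.div_const a)))
  simp only [hdiv] at h0
  rw [integral_const_mul, integral_add (integrable_const _) (hint.div_const a),
    integral_div, integral_const, smul_eq_mul, mul_one] at h0
  have harea : (areaMeasure φ).real Set.univ
      = -(1 / a) * ∫ p, ‖meanCurvature φ p‖ ^ 2 ∂(areaMeasure φ) := by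
    linear_combination h0 / 2
  refine ⟨?_, measure_lt_top _ _, hint, harea⟩
  -- If `0 ≤ a`, the area formula would make the positive area nonpositive.
  by_contra hpos
  have hpos' : 0 < (areaMeasure φ).real Set.univ :=
    ENNReal.toReal_pos (areaMeasure_univ_ne_zero himm) (measure_ne_top _ _)
  have h1 : 0 ≤ (1 / a) * ∫ p, ‖meanCurvature φ p‖ ^ 2 ∂(areaMeasure φ) :=
    mul_nonneg (one_div_nonneg.2 (not_lt.1 hpos)) (integral_nonneg fun p => sq_nonneg _)
  linarith
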